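/- Let $\alpha,\beta\in\mathbb{C}$ satisfy $\operatorname{Re}(\alpha)>0$, $\operatorname{Re}(\beta)>0$ and $\alpha\beta=4\pi^2$, and let $m\geq 1$ be an integer. Let $\psi=\Gamma'/\Gamma$ denote the digamma function, $\zeta$ the Riemann zeta function and $\gamma$ Euler's constant. Then both infinite series below converge absolutely, and $$\begin{aligned} &\alpha^{-m}\left\{2\gamma\zeta(2m+1)+\sum_{n=1}^\infty\frac{1}{n^{2m+1}}\left(\psi\left(\frac{in\alpha}{2\pi}\right)+\psi\left(-\frac{in\alpha}{2\pi}\right)\right)\right\}\\ &\quad=-(-\beta)^{-m}\left\{2\gamma\zeta(2m+1)+\sum_{n=1}^\infty\frac{1}{n^{2m+1}}\left(\psi\left(\frac{in\beta}{2\pi}\right)+\psi\left(-\frac{in\beta}{2\pi}\right)\right)\right\}\\ &\qquad-2\sum_{j=1}^{m-1}(-1)^j\,\zeta(2m+1-2j)\,\zeta(2j+1)\,\alpha^{j-m}\beta^{-j}, \end{aligned}$$ where the finite sum is empty, hence $0$, when $m=1$. -/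

import Mathlib

open Filter Topology

/-! ### Partial fractions of the digamma function from Euler's product. -/

namespace Complex

/-! Put `a = α/2π`, `b = β/2π`, so `ab = 1`, and `m = M + 1`. The partial fractions of `ψ(z) + ψ(-z)
+ 2γ` at `z = ina` turn each brace into twice an absolutely convergent double series of
`lambertTerm` (`hasSum_digamma_series`). Exchanging `n, k` and `a, b` changes this series only by a
factor and a finite geometric sum (`lambertTerm_add_swap`), whose terms separate into powers of `n`
and `k` and sum to the zeta products.

The partial fractions (`hasSum_digamma`) come from differentiating the logarithm of the Weierstrass
product for Gamma, then using the functional equation to leave the right half-plane. -/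

theorem half_mul_le_norm_nat_add_one_add {z : ℂ} (hz : -(1 / 2) < z.re) (k : ℕ) :
    ((k : ℝ) + 1) / 2 ≤ ‖(k : ℂ) + 1 + z‖ := by
  refine le_trans ?_ (re_le_norm _)
  simp only [add_re, natCast_re, one_re]
  have : (0 : ℝ) ≤ k := k.cast_nonneg
  linarith

theorem one_add_div_mem_slitPlane {z : ℂ} (hz : -(1 / 2) < z.re) (k : ℕ) :
    1 + z / ((k : ℂ) + 1) ∈ slitPlane := by
  left
  have e : (z / ((k : ℂ) + 1)).re = z.re / ((k : ℝ) + 1) := by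
    have : ((k : ℂ) + 1) = (((k : ℝ) + 1 : ℝ) : ℂ) := by push_cast; rfl
    rw [this, div_ofReal_re]
  rw [add_re, one_re, e]
  have hk : (0 : ℝ) < (k : ℝ) + 1 := by positivity
  have : -1 < z.re / ((k : ℝ) + 1) := by
    rw [lt_div_iff₀ hk]
    have : (0 : ℝ) ≤ k := k.cast_nonneg
    linarith
  linarith

theorem hasDerivAt_logGamma_term {z : ℂ} (hz : -(1 / 2) < z.re) (k : ℕ) :
    HasDerivAt (fun z : ℂ => z / ((k : ℂ) + 1) - log (1 + z / ((k : ℂ) + 1)))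
      (1 / ((k : ℂ) + 1) - 1 / ((k : ℂ) + 1 + z)) z := by
  have hk : (k : ℂ) + 1 ≠ 0 := Nat.cast_add_one_ne_zero k
  have h1 : HasDerivAt (fun z : ℂ => z / ((k : ℂ) + 1)) (1 / ((k : ℂ) + 1)) z :=
    (hasDerivAt_id z).div_const _
  have hs := one_add_div_mem_slitPlane hz k
  have h2 := (h1.const_add 1).clog hs
  refine (h1.sub h2).congr_deriv ?_
  have h3 : (k : ℂ) + 1 + z ≠ 0 := by
    intro h
    have := half_mul_le_norm_nat_add_one_add hz k
    rw [h, norm_zero] at this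
    have : (0 : ℝ) ≤ k := k.cast_nonneg
    linarith
  have h4 : 1 + z / ((k : ℂ) + 1) ≠ 0 := slitPlane_ne_zero hs
  rw [div_div, mul_add, mul_one, mul_div_cancel₀ _ hk]

theorem norm_one_div_sub_one_div_le {z : ℂ} (hz : -(1 / 2) < z.re) (k : ℕ) :
    ‖1 / ((k : ℂ) + 1) - 1 / ((k : ℂ) + 1 + z)‖ ≤ 2 * ‖z‖ * (1 / ((k : ℝ) + 1) ^ 2) := by
  have hk : (k : ℂ) + 1 ≠ 0 := Nat.cast_add_one_ne_zero k
  have hk' : (0 : ℝ) < (k : ℝ) + 1 := by positivity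
  have hb := half_mul_le_norm_nat_add_one_add hz k
  have h3 : (k : ℂ) + 1 + z ≠ 0 := by
    intro h
    rw [h, norm_zero] at hb
    linarith
  have e : 1 / ((k : ℂ) + 1) - 1 / ((k : ℂ) + 1 + z) =
      z / (((k : ℂ) + 1) * ((k : ℂ) + 1 + z)) := by
    field_simp
    ring
  have hn : ‖(k : ℂ) + 1‖ = (k : ℝ) + 1 := by
    exact_mod_cast norm_natCast (k + 1)
  rw [e, norm_div, norm_mul, hn]
  calc ‖z‖ / (((k : ℝ) + 1) * ‖(k : ℂ) + 1 + z‖)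
      ≤ ‖z‖ / (((k : ℝ) + 1) * (((k : ℝ) + 1) / 2)) := by gcongr
    _ = 2 * ‖z‖ * (1 / ((k : ℝ) + 1) ^ 2) := by field_simp

theorem summable_one_div_nat_add_one_sq : Summable fun k : ℕ => 1 / ((k : ℝ) + 1) ^ 2 := by
  have := (summable_nat_add_iff (f := fun k : ℕ => 1 / (k : ℝ) ^ 2) 1).2
    (Real.summable_one_div_nat_pow.2 one_lt_two)
  simpa using this

/-- Termwise differentiation, with derivatives dominated by a multiple of `1/(k+1)^2`. The
half-plane reaches left of 0 so that 0, where every term vanishes, can serve as base point. -/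
theorem logGamma_series {z : ℂ} (hz : -(1 / 2) < z.re) :
    Summable (fun k : ℕ => z / ((k : ℂ) + 1) - log (1 + z / ((k : ℂ) + 1))) ∧
    HasDerivAt (fun z : ℂ => ∑' k : ℕ, (z / ((k : ℂ) + 1) - log (1 + z / ((k : ℂ) + 1))))
      (∑' k : ℕ, (1 / ((k : ℂ) + 1) - 1 / ((k : ℂ) + 1 + z))) z := by
  set R := ‖z‖ + 1
  let t : Set ℂ := {w | -(1 / 2) < w.re} ∩ Metric.ball 0 R
  have ht : IsOpen t := (isOpen_lt continuous_const continuous_re).inter Metric.isOpen_ball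
  have ht' : IsPreconnected t :=
    ((convex_halfSpace_re_gt _).inter (convex_ball 0 R)).isPreconnected
  have hu : Summable fun k : ℕ => 2 * R * (1 / ((k : ℝ) + 1) ^ 2) :=
    summable_one_div_nat_add_one_sq.mul_left _
  have hzt : z ∈ t := ⟨hz, by simp [R]⟩
  have h0 : (0 : ℂ) ∈ t := ⟨by simp, by simp only [Metric.mem_ball, dist_self, R]; positivity⟩
  have hg : ∀ (k : ℕ) (y : ℂ), y ∈ t →
      HasDerivAt (fun z : ℂ => z / ((k : ℂ) + 1) - log (1 + z / ((k : ℂ) + 1)))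
      (1 / ((k : ℂ) + 1) - 1 / ((k : ℂ) + 1 + y)) y :=
    fun k y hy => hasDerivAt_logGamma_term hy.1 k
  have hg' : ∀ (k : ℕ) (y : ℂ), y ∈ t →
      ‖1 / ((k : ℂ) + 1) - 1 / ((k : ℂ) + 1 + y)‖ ≤ 2 * R * (1 / ((k : ℝ) + 1) ^ 2) := by
    intro k y hy
    refine (norm_one_div_sub_one_div_le hy.1 k).trans ?_
    have : ‖y‖ ≤ R := by simpa using (mem_ball_zero_iff.1 hy.2).le
    gcongr
  have hg0 : Summable fun k : ℕ => (0 : ℂ) / ((k : ℂ) + 1) - log (1 + 0 / ((k : ℂ) + 1)) := by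
    simp [summable_zero]
  exact ⟨summable_of_summable_hasDerivAt_of_isPreconnected
      (g := fun (k : ℕ) (z : ℂ) => z / ((k : ℂ) + 1) - log (1 + z / ((k : ℂ) + 1)))
      (g' := fun (k : ℕ) (z : ℂ) => 1 / ((k : ℂ) + 1) - 1 / ((k : ℂ) + 1 + z))
      hu ht ht' hg hg' h0 hg0 hzt,
    hasDerivAt_tsum_of_isPreconnected
      (g := fun (k : ℕ) (z : ℂ) => z / ((k : ℂ) + 1) - log (1 + z / ((k : ℂ) + 1)))
      (g' := fun (k : ℕ) (z : ℂ) => 1 / ((k : ℂ) + 1) - 1 / ((k : ℂ) + 1 + z))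
      hu ht ht' hg hg' h0 hg0 hzt⟩

theorem exp_sum_logGamma_terms {z : ℂ} (hz : 0 < z.re) {n : ℕ} (hn : n ≠ 0) :
    exp (∑ k ∈ Finset.range n, (z / ((k : ℂ) + 1) - log (1 + z / ((k : ℂ) + 1)))) =
      z * GammaSeq z n * exp (z * ((harmonic n - Real.log n : ℝ) : ℂ)) := by
  have hz0 : z ≠ 0 := fun h => by simp [h] at hz
  have hz' : -(1 / 2) < z.re := by linarith
  have h1 : ∏ k ∈ Finset.range n, (1 + z / ((k : ℂ) + 1)) =
      (∏ k ∈ Finset.range n, (z + ((k + 1 : ℕ) : ℂ))) / (Nat.factorial n : ℂ) := by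
    rw [← Finset.prod_range_add_one_eq_factorial, Nat.cast_prod, ← Finset.prod_div_distrib]
    refine Finset.prod_congr rfl fun k _ => ?_
    have hk : (k : ℂ) + 1 ≠ 0 := Nat.cast_add_one_ne_zero k
    push_cast
    field_simp
    ring
  have h2 : exp (∑ k ∈ Finset.range n, log (1 + z / ((k : ℂ) + 1))) =
      ∏ k ∈ Finset.range n, (1 + z / ((k : ℂ) + 1)) := by
    rw [exp_sum]
    exact Finset.prod_congr rfl fun k _ =>
      exp_log (slitPlane_ne_zero (one_add_div_mem_slitPlane hz' k))
  have h3 : ∏ k ∈ Finset.range n, (z + ((k + 1 : ℕ) : ℂ)) ≠ 0 := by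
    refine Finset.prod_ne_zero_iff.2 fun k _ h => ?_
    have := congrArg re h
    simp only [add_re, natCast_re, zero_re] at this
    have : (0 : ℝ) ≤ (k + 1 : ℕ) := Nat.cast_nonneg _
    linarith
  have hf : (Nat.factorial n : ℂ) ≠ 0 := Nat.cast_ne_zero.2 n.factorial_ne_zero
  have hn0 : (n : ℂ) ≠ 0 := Nat.cast_ne_zero.2 hn
  have h4 : ∑ k ∈ Finset.range n, z / ((k : ℂ) + 1) = z * ((harmonic n : ℚ) : ℂ) := by
    rw [harmonic]
    push_cast
    rw [Finset.mul_sum]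
    rfl
  rw [Finset.sum_sub_distrib, exp_sub, h2, h1, h4, GammaSeq, Finset.prod_range_succ',
    cpow_def_of_ne_zero hn0]
  push_cast
  rw [mul_sub, exp_sub, mul_comm (log (n : ℂ)) z]
  have := exp_ne_zero (z * log n)
  push_cast at h3
  rw [add_zero]
  field_simp

/-- The limit of Euler's finite products: the factor `n^z` and the harmonic sum combine into
`harmonic n - log n`, which tends to `γ`. -/
theorem exp_logGamma_series {z : ℂ} (hz : 0 < z.re) :
    exp (∑' k : ℕ, (z / ((k : ℂ) + 1) - log (1 + z / ((k : ℂ) + 1)))) =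
      z * Gamma z * exp (z * Real.eulerMascheroniConstant) := by
  have h1 := (logGamma_series (z := z) (by linarith)).1.hasSum.tendsto_sum_nat.cexp
  have h2 : Tendsto (fun n : ℕ => z * GammaSeq z n * exp (z * ((harmonic n - Real.log n : ℝ) : ℂ)))
      atTop (𝓝 (z * Gamma z * exp (z * Real.eulerMascheroniConstant))) := by
    refine ((GammaSeq_tendsto_Gamma z).const_mul z).mul (Tendsto.cexp ?_)
    exact ((continuous_ofReal.tendsto _).comp Real.tendsto_harmonic_sub_log).const_mul z
  refine tendsto_nhds_unique h1 (h2.congr' ?_)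
  filter_upwards [eventually_ne_atTop 0] with n hn
  exact (exp_sum_logGamma_terms hz hn).symm

theorem ne_neg_nat_of_re_pos {z : ℂ} (hz : 0 < z.re) (n : ℕ) : z ≠ -n := by
  rintro rfl
  simp only [neg_re, natCast_re] at hz
  have : (0 : ℝ) ≤ n := n.cast_nonneg
  linarith

theorem hasSum_digamma_add_one_of_re_pos {z : ℂ} (hz : 0 < z.re) :
    HasSum (fun k : ℕ => 1 / ((k : ℂ) + 1) - 1 / ((k : ℂ) + 1 + z))
      (digamma (z + 1) + Real.eulerMascheroniConstant) := by
  have hz' : -(1 / 2) < z.re := by linarith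
  have hs : Summable fun k : ℕ => 1 / ((k : ℂ) + 1) - 1 / ((k : ℂ) + 1 + z) :=
    Summable.of_norm_bounded (summable_one_div_nat_add_one_sq.mul_left _)
      (norm_one_div_sub_one_div_le hz')
  convert hs.hasSum using 1
  have hz0 : z ≠ 0 := fun h => by simp [h] at hz
  have hG := Gamma_ne_zero_of_re_pos hz
  have hd := differentiableAt_Gamma z (ne_neg_nat_of_re_pos hz)
  have h1 := (logGamma_series hz').2.cexp
  have h2 : HasDerivAt (fun z : ℂ => z * Gamma z * exp (z * Real.eulerMascheroniConstant))
      ((1 * Gamma z + z * deriv Gamma z) * exp (z * Real.eulerMascheroniConstant) +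
        z * Gamma z * (exp (z * Real.eulerMascheroniConstant) *
          (1 * Real.eulerMascheroniConstant))) z :=
    ((hasDerivAt_id z).mul hd.hasDerivAt).mul (((hasDerivAt_id z).mul_const _).cexp)
  have h3 := (h1.congr_of_eventuallyEq (f₁ := fun z : ℂ => z * Gamma z *
    exp (z * Real.eulerMascheroniConstant)) (by
      filter_upwards [(isOpen_lt continuous_const continuous_re).mem_nhds hz] with w hw
      exact (exp_logGamma_series hw).symm)).unique h2
  rw [exp_logGamma_series hz] at h3
  rw [digamma_apply_add_one z (ne_neg_nat_of_re_pos hz), digamma_def, logDeriv_apply]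
  have he := exp_ne_zero (z * Real.eulerMascheroniConstant)
  have h4 : z * Gamma z * exp (z * Real.eulerMascheroniConstant) ≠ 0 :=
    mul_ne_zero (mul_ne_zero hz0 hG) he
  apply mul_left_cancel₀ h4
  rw [h3]
  field_simp
  ring

theorem hasSum_one_div_sub_one_div_shift {w : ℂ} (hw : ∀ n : ℕ, w ≠ -n) :
    HasSum (fun k : ℕ => 1 / ((k : ℂ) + (w + 1)) - 1 / ((k : ℂ) + w)) (-w⁻¹) := by
  have h0 : ∀ k : ℕ, (k : ℂ) + w ≠ 0 := fun k h => hw k (by linear_combination h)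
  have h1 : ∀ k : ℕ, (k : ℂ) + (w + 1) ≠ 0 := fun k h => h0 (k + 1) (by
    push_cast
    linear_combination h)
  have hs : Summable fun k : ℕ => 1 / ((k : ℂ) + (w + 1)) - 1 / ((k : ℂ) + w) := by
    refine Summable.of_norm_bounded_eventually_nat
      ((Real.summable_one_div_nat_pow.2 one_lt_two).mul_left 4) ?_
    -- Beyond this threshold both denominators have norm at least `k/2`.
    filter_upwards [eventually_ge_atTop (⌈2 * ‖w + 1‖ + 2 * ‖w‖⌉₊ + 1)] with k hk
    have hk1 : 2 * ‖w + 1‖ + 2 * ‖w‖ ≤ k := (Nat.le_ceil _).trans (by exact_mod_cast by omega)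
    have hk0 : (0 : ℝ) < k := by exact_mod_cast by omega
    have b : ∀ v : ℂ, 2 * ‖v‖ ≤ k → (k : ℝ) / 2 ≤ ‖(k : ℂ) + v‖ := by
      intro v hv
      have := norm_sub_le ((k : ℂ) + v) v
      rw [add_sub_cancel_right, norm_natCast] at this
      linarith
    have e : 1 / ((k : ℂ) + (w + 1)) - 1 / ((k : ℂ) + w) =
        -1 / (((k : ℂ) + (w + 1)) * ((k : ℂ) + w)) := by
      have := h0 k
      have := h1 k
      field_simp
      ring
    have b1 := b (w + 1) (by linarith [norm_nonneg w])
    have b2 := b w (by linarith [norm_nonneg (w + 1)])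
    rw [e, norm_div, norm_mul, norm_neg, norm_one]
    calc 1 / (‖(k : ℂ) + (w + 1)‖ * ‖(k : ℂ) + w‖) ≤ 1 / ((k : ℝ) / 2 * ((k : ℝ) / 2)) := by gcongr
      _ = 4 * (1 / (k : ℝ) ^ 2) := by
        field_simp
        norm_num
  rw [hs.hasSum_iff_tendsto_nat]
  have ht : Tendsto (fun n : ℕ => 1 / ((n : ℂ) + w)) atTop (𝓝 0) := by
    simp_rw [one_div]
    exact tendsto_inv₀_cobounded.comp
      ((tendsto_add_const_cobounded w).comp tendsto_natCast_atTop_cobounded)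
  have := ht.sub_const w⁻¹
  rw [zero_sub] at this
  refine this.congr fun n => ?_
  have := Finset.sum_range_sub (fun k : ℕ => 1 / ((k : ℂ) + w)) n
  simp only [Nat.cast_zero, zero_add, one_div] at this ⊢
  rw [← this]
  refine Finset.sum_congr rfl fun k _ => ?_
  push_cast
  ring

/-- The partial fraction expansion of the digamma function. -/
theorem hasSum_digamma {z : ℂ} (hz : ∀ n : ℕ, z ≠ -n) :
    HasSum (fun k : ℕ => 1 / ((k : ℂ) + 1) - 1 / ((k : ℂ) + z))
      (digamma z + Real.eulerMascheroniConstant) := by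
  have step : ∀ w : ℂ, (∀ n : ℕ, w ≠ -n) →
      HasSum (fun k : ℕ => 1 / ((k : ℂ) + 1) - 1 / ((k : ℂ) + (w + 1)))
        (digamma (w + 1) + Real.eulerMascheroniConstant) →
      HasSum (fun k : ℕ => 1 / ((k : ℂ) + 1) - 1 / ((k : ℂ) + w))
        (digamma w + Real.eulerMascheroniConstant) := by
    intro w hw h
    have hw0 : w ≠ 0 := by simpa using hw 0
    rw [digamma_apply_add_one w hw] at h
    convert h.add (hasSum_one_div_sub_one_div_shift hw) using 1
    · ext k
      ring
    · ring
  -- Here `n` counts the unit shifts needed to reach real part above 1, where the expansion already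
  -- holds at `w = (w - 1) + 1`.
  have main : ∀ n : ℕ, ∀ w : ℂ, (∀ n : ℕ, w ≠ -n) → 1 < w.re + n →
      HasSum (fun k : ℕ => 1 / ((k : ℂ) + 1) - 1 / ((k : ℂ) + w))
        (digamma w + Real.eulerMascheroniConstant) := by
    intro n
    induction n with
    | zero =>
      intro w _ h1
      have h2 : 0 < (w - 1).re := by
        simp only [sub_re, one_re]
        simp only [Nat.cast_zero, add_zero] at h1
        linarith
      convert hasSum_digamma_add_one_of_re_pos h2 using 3
      · ring
      · ring_nf
    | succ n ih =>
      intro w hw h1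
      refine step w hw (ih (w + 1) (fun k hk => hw (k + 1) ?_) ?_)
      · push_cast
        linear_combination hk
      · simp only [add_re, one_re]
        push_cast at h1
        linarith
  obtain ⟨n, hn⟩ := exists_nat_gt (1 - z.re)
  exact main n z hz (by linarith)

end Complex


namespace Complex

/-- The even part of the digamma function, expanded into partial fractions. -/
theorem hasSum_digamma_add_digamma_neg {z : ℂ} (hz : ∀ n : ℤ, z ≠ n) :
    HasSum (fun k : ℕ+ => 2 / (k : ℂ) - 2 * k / ((k : ℂ) ^ 2 - z ^ 2))
      (digamma z + digamma (-z) + 2 * Real.eulerMascheroniConstant) := by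
  have hz1 : ∀ n : ℕ, z ≠ -n := fun n => by simpa using hz (-n)
  have hz2 : ∀ n : ℕ, -z ≠ -n := fun n h => hz n (by simpa using h)
  have h1 : ∀ n : ℕ, z + 1 ≠ -n := fun n h => hz1 (n + 1) (by
    push_cast
    linear_combination h)
  have h2 : ∀ n : ℕ, -z + 1 ≠ -n := fun n h => hz2 (n + 1) (by
    push_cast
    linear_combination h)
  have h := (hasSum_digamma h1).add (hasSum_digamma h2)
  -- The shift by 1 makes the denominators `k + 1 ± z`; the corrections `1/z` and `1/(-z)` cancel.
  rw [digamma_apply_add_one z hz1, digamma_apply_add_one (-z) hz2] at h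
  rw [← Equiv.pnatEquivNat.symm.hasSum_iff]
  convert h using 1
  · ext k
    have e1 : (k : ℂ) + (z + 1) ≠ 0 := fun h => h1 k (by linear_combination h)
    have e2 : (k : ℂ) + (-z + 1) ≠ 0 := fun h => h2 k (by linear_combination h)
    have e3 : (k : ℂ) + 1 ≠ 0 := Nat.cast_add_one_ne_zero k
    have e4 : ((k : ℂ) + 1) ^ 2 - z ^ 2 ≠ 0 := by
      rw [show ((k : ℂ) + 1) ^ 2 - z ^ 2 = ((k : ℂ) + (z + 1)) * ((k : ℂ) + (-z + 1)) by ring]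
      exact mul_ne_zero e1 e2
    simp only [Function.comp_apply, Equiv.pnatEquivNat_symm_apply, Nat.succPNat_coe,
      Nat.succ_eq_add_one, Nat.cast_add, Nat.cast_one]
    field_simp
    ring
  · rw [inv_neg]
    ring

end Complex

/-! ### The double series and its symmetry. -/

/-- The double series term underlying Ramanujan's transformation formula. -/
noncomputable def lambertTerm (M : ℕ) (a : ℂ) (p : ℕ+ × ℕ+) : ℂ :=
  a ^ 2 / ((p.1 : ℂ) ^ (2 * M + 1) * p.2 * ((p.2 : ℂ) ^ 2 + (p.1 : ℂ) ^ 2 * a ^ 2))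

/-- By `ab = 1` the quantity factors as `(k + ina) · a(kb - in)`; the first factor is bounded by its
imaginary part, `kb - in` by its real part. The resulting factor `nk` gives absolute convergence
even for `M = 0`. -/
theorem le_norm_sq_add_sq_mul_sq {a b : ℂ} (hb : 0 < b.re) (hab : a * b = 1)
    (n k : ℕ+) :
    a.re * ‖a‖ * b.re * (n * k) ≤ ‖(k : ℂ) ^ 2 + (n : ℂ) ^ 2 * a ^ 2‖ := by
  have e : (k : ℂ) ^ 2 + (n : ℂ) ^ 2 * a ^ 2 =
      ((k : ℂ) + Complex.I * n * a) * (a * (k * b - Complex.I * n)) := by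
    linear_combination (-(k : ℂ) ^ 2 - k * Complex.I * n * a) * hab +
      (n : ℂ) ^ 2 * a ^ 2 * Complex.I_sq
  have h1 : (n : ℝ) * a.re ≤ ‖(k : ℂ) + Complex.I * n * a‖ := by
    refine le_trans (le_of_eq ?_) (Complex.im_le_norm _)
    simp
  have h2 : (k : ℝ) * b.re ≤ ‖(k : ℂ) * b - Complex.I * n‖ := by
    refine le_trans (le_of_eq ?_) (Complex.re_le_norm _)
    simp
  rw [e, norm_mul, norm_mul]
  calc a.re * ‖a‖ * b.re * (n * k) = (n * a.re) * (‖a‖ * (k * b.re)) := by ring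
    _ ≤ _ := mul_le_mul h1 (mul_le_mul_of_nonneg_left h2 (norm_nonneg a))
      (by positivity) (norm_nonneg _)

theorem sq_add_sq_mul_sq_ne_zero {a b : ℂ} (ha : 0 < a.re) (hb : 0 < b.re) (hab : a * b = 1)
    (n k : ℕ+) : (k : ℂ) ^ 2 + (n : ℂ) ^ 2 * a ^ 2 ≠ 0 := by
  have h := le_norm_sq_add_sq_mul_sq hb hab n k
  have : 0 < ‖a‖ := norm_pos_iff.2 fun h => by simp [h] at ha
  have hn : (0 : ℝ) < n := by exact_mod_cast n.pos
  have hk : (0 : ℝ) < k := by exact_mod_cast k.pos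
  exact norm_pos_iff.1 (lt_of_lt_of_le (by positivity) h)

theorem summable_pnat_one_div_pow {r : ℕ} (hr : 1 < r) :
    Summable fun n : ℕ+ => 1 / (n : ℝ) ^ r :=
  (Real.summable_one_div_nat_pow.2 hr).comp_injective PNat.coe_injective

theorem hasSum_pnat_one_div_pow {r : ℕ} (hr : 1 < r) :
    HasSum (fun n : ℕ+ => 1 / (n : ℂ) ^ r) (riemannZeta r) := by
  have h : HasSum (fun n : ℕ => 1 / (n : ℂ) ^ r) (riemannZeta r) := by
    rw [zeta_nat_eq_tsum_of_gt_one hr]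
    refine (Summable.of_norm ?_).hasSum
    simpa using Real.summable_one_div_nat_pow.2 hr
  refine (PNat.coe_injective.hasSum_iff ?_).2 h
  -- Only `n = 0` is missed by `ℕ+`, and there `1 / 0 ^ r = 0`.
  intro n hn
  have : n = 0 := by
    by_contra h0
    exact hn ⟨⟨n, Nat.pos_of_ne_zero h0⟩, rfl⟩
  simp [this, show r ≠ 0 by omega]

theorem summable_lambertTerm (M : ℕ) {a b : ℂ} (ha : 0 < a.re) (hb : 0 < b.re)
    (hab : a * b = 1) : Summable (lambertTerm M a) := by
  have ha0 : 0 < ‖a‖ := norm_pos_iff.2 fun h => by simp [h] at ha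
  have hs : Summable fun p : ℕ+ × ℕ+ => 1 / (p.1 : ℝ) ^ (2 * M + 2) * (1 / (p.2 : ℝ) ^ 2) :=
    (summable_pnat_one_div_pow (by omega)).mul_of_nonneg (summable_pnat_one_div_pow one_lt_two)
      (fun _ => by positivity) (fun _ => by positivity)
  refine Summable.of_norm_bounded (hs.mul_left (‖a‖ / (a.re * b.re))) fun p => ?_
  obtain ⟨n, k⟩ := p
  have h := le_norm_sq_add_sq_mul_sq hb hab n k
  have hn : (0 : ℝ) < n := by exact_mod_cast n.pos
  have hk : (0 : ℝ) < k := by exact_mod_cast k.pos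
  simp only [lambertTerm, norm_div, norm_mul, norm_pow, Complex.norm_natCast]
  calc ‖a‖ ^ 2 / ((n : ℝ) ^ (2 * M + 1) * k * ‖(k : ℂ) ^ 2 + (n : ℂ) ^ 2 * a ^ 2‖)
      ≤ ‖a‖ ^ 2 / ((n : ℝ) ^ (2 * M + 1) * k * (a.re * ‖a‖ * b.re * (n * k))) := by gcongr
    _ = _ := by
      field_simp
      ring

/-- With `x = 1/n²` and `y = -a²/k²`, the two terms are `a²x^M/(nkD)` and `-a²y^M/(nkD)`, where `D =
n²k²(x - y)`. So this is the factorisation of `y^M - x^M` by `y - x`. -/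
theorem lambertTerm_add_swap (M : ℕ) {a b : ℂ} (ha : 0 < a.re) (hb : 0 < b.re)
    (hab : a * b = 1) (n k : ℕ+) :
    lambertTerm M a (n, k) + (-1) ^ (M + 1) * a ^ (2 * M + 2) * lambertTerm M b (k, n) +
      ∑ j ∈ Finset.Icc 1 M, (-1) ^ j * a ^ (2 * j) *
        (1 / (n : ℂ) ^ (2 * (M + 1 - j) + 1) * (1 / (k : ℂ) ^ (2 * j + 1))) = 0 := by
  have ha0 : a ≠ 0 := fun h => by simp [h] at ha
  have hn : (n : ℂ) ≠ 0 := Nat.cast_ne_zero.2 n.ne_zero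
  have hk : (k : ℂ) ≠ 0 := Nat.cast_ne_zero.2 k.ne_zero
  have hD := sq_add_sq_mul_sq_ne_zero ha hb hab n k
  obtain rfl : b = a⁻¹ := (inv_eq_of_mul_eq_one_right hab).symm
  set D := (k : ℂ) ^ 2 + (n : ℂ) ^ 2 * a ^ 2
  set x : ℂ := ((n : ℂ) ^ 2)⁻¹ with hx
  set y : ℂ := -a ^ 2 * ((k : ℂ) ^ 2)⁻¹ with hy
  have e1 : lambertTerm M a (n, k) = a ^ 2 * x ^ M / (n * k * D) := by
    simp only [lambertTerm, hx, D, inv_pow, ← pow_mul]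
    field_simp
    ring
  have e2 : (-1) ^ (M + 1) * a ^ (2 * M + 2) * lambertTerm M a⁻¹ (k, n) =
      -(a ^ 2 * y ^ M / (n * k * D)) := by
    have hD' : (n : ℂ) ^ 2 + (k : ℂ) ^ 2 * a⁻¹ ^ 2 = D * a⁻¹ ^ 2 := by
      simp only [D]
      field_simp
      ring
    have hy' : y ^ M = (-1) ^ M * a ^ (2 * M) * ((k : ℂ) ^ (2 * M))⁻¹ := by
      rw [hy, mul_pow, neg_pow, inv_pow, ← pow_mul, ← pow_mul]
    simp only [lambertTerm]
    rw [hD', hy']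
    field_simp
    ring
  have e3 : ∑ j ∈ Finset.Icc 1 M, (-1) ^ j * a ^ (2 * j) *
        (1 / (n : ℂ) ^ (2 * (M + 1 - j) + 1) * (1 / (k : ℂ) ^ (2 * j + 1))) =
      x * y / (n * k) * ∑ i ∈ Finset.range M, y ^ i * x ^ (M - 1 - i) := by
    rw [Finset.mul_sum, ← Finset.Ico_add_one_right_eq_Icc, Finset.sum_Ico_eq_sum_range]
    refine Finset.sum_congr rfl fun i hi => ?_
    have hi' : i < M := Finset.mem_range.1 hi
    obtain ⟨d, rfl⟩ : ∃ d, M = i + 1 + d := ⟨M - i - 1, by omega⟩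
    rw [show i + 1 + d + 1 - (1 + i) = d + 1 by omega, show i + 1 + d - 1 - i = d by omega]
    have hy' : y ^ i = (-1) ^ i * a ^ (2 * i) * ((k : ℂ) ^ (2 * i))⁻¹ := by
      rw [hy, mul_pow, neg_pow, inv_pow, ← pow_mul, ← pow_mul]
    rw [hy', hx, hy, inv_pow, ← pow_mul]
    field_simp
    ring
  have hxy : (y - x) * (n ^ 2 * k ^ 2) = -D := by
    simp only [hx, hy, D]
    field_simp
    ring
  have hg := (Commute.all y x).geom_sum₂_mul M
  have hxy' : x * y * (n ^ 2 * k ^ 2) = -a ^ 2 := by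
    simp only [hx, hy]
    field_simp
  have e4 : x * y * ∑ i ∈ Finset.range M, y ^ i * x ^ (M - 1 - i) =
      a ^ 2 * (y ^ M - x ^ M) / D := by
    rw [eq_div_iff hD, ← hg]
    linear_combination (x * y * ∑ i ∈ Finset.range M, y ^ i * x ^ (M - 1 - i)) * hxy -
      (∑ i ∈ Finset.range M, y ^ i * x ^ (M - 1 - i)) * (y - x) * hxy'
  rw [e1, e2, e3, div_mul_eq_mul_div, e4]
  field_simp
  ring

theorem hasSum_mul_of_summable_norm {f g : ℕ+ → ℂ} {s t : ℂ} (hf : HasSum f s) (hg : HasSum g t)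
    (hf' : Summable fun n => ‖f n‖) (hg' : Summable fun n => ‖g n‖) :
    HasSum (fun p : ℕ+ × ℕ+ => f p.1 * g p.2) (s * t) :=
  hf.mul hg (summable_mul_of_summable_norm hf' hg')

theorem tsum_lambertTerm_add_swap (M : ℕ) {a b : ℂ} (ha : 0 < a.re) (hb : 0 < b.re)
    (hab : a * b = 1) :
    ∑' p, lambertTerm M a p + (-1) ^ (M + 1) * a ^ (2 * M + 2) * ∑' p, lambertTerm M b p +
      ∑ j ∈ Finset.Icc 1 M, (-1) ^ j * a ^ (2 * j) *
        (riemannZeta (2 * (M + 1 - j) + 1 : ℕ) * riemannZeta (2 * j + 1 : ℕ)) = 0 := by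
  have h1 := (summable_lambertTerm M ha hb hab).hasSum
  have h2 := (Equiv.prodComm ℕ+ ℕ+).hasSum_iff.2
    (summable_lambertTerm M hb ha (by rw [mul_comm, hab])).hasSum
  have h3 : ∀ j ∈ Finset.Icc 1 M, HasSum (fun p : ℕ+ × ℕ+ => (-1) ^ j * a ^ (2 * j) *
        (1 / (p.1 : ℂ) ^ (2 * (M + 1 - j) + 1) * (1 / (p.2 : ℂ) ^ (2 * j + 1))))
      ((-1) ^ j * a ^ (2 * j) *
        (riemannZeta (2 * (M + 1 - j) + 1 : ℕ) * riemannZeta (2 * j + 1 : ℕ))) := by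
    intro j hj
    rw [Finset.mem_Icc] at hj
    have r1 : 1 < 2 * (M + 1 - j) + 1 := by omega
    have r2 : 1 < 2 * j + 1 := by omega
    have s1 : Summable fun n : ℕ+ => ‖1 / (n : ℂ) ^ (2 * (M + 1 - j) + 1)‖ := by
      simpa using summable_pnat_one_div_pow r1
    have s2 : Summable fun n : ℕ+ => ‖1 / (n : ℂ) ^ (2 * j + 1)‖ := by
      simpa using summable_pnat_one_div_pow r2
    exact (hasSum_mul_of_summable_norm (hasSum_pnat_one_div_pow r1) (hasSum_pnat_one_div_pow r2)
      s1 s2).mul_left _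
  have h := (h1.add (h2.mul_left ((-1) ^ (M + 1) * a ^ (2 * M + 2)))).add (hasSum_sum h3)
  exact h.unique (hasSum_zero.congr_fun fun p => lambertTerm_add_swap M ha hb hab p.1 p.2)

/-! ### From the double series back to digamma. -/

theorem hasSum_digamma_series (M : ℕ) {a b : ℂ} (ha : 0 < a.re) (hb : 0 < b.re)
    (hab : a * b = 1) :
    HasSum (fun n : ℕ+ => 1 / (n : ℂ) ^ (2 * (M + 1) + 1) *
        (Complex.digamma (Complex.I * n * a) + Complex.digamma (-(Complex.I * n * a))))
      (2 * ∑' p, lambertTerm M a p -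
        2 * Real.eulerMascheroniConstant * riemannZeta (2 * (M + 1) + 1 : ℕ)) := by
  have hs := (summable_lambertTerm M ha hb hab).hasSum.mul_left 2
  have hz := (hasSum_pnat_one_div_pow (r := 2 * (M + 1) + 1) (by omega)).mul_left
    (2 * (Real.eulerMascheroniConstant : ℂ))
  have hfib : ∀ n : ℕ+, HasSum (fun k : ℕ+ => 2 * lambertTerm M a (n, k))
      (1 / (n : ℂ) ^ (2 * (M + 1) + 1) *
        (Complex.digamma (Complex.I * n * a) + Complex.digamma (-(Complex.I * n * a)) +
          2 * Real.eulerMascheroniConstant)) := by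
    intro n
    have hn : (n : ℂ) ≠ 0 := Nat.cast_ne_zero.2 n.ne_zero
    have hne : ∀ j : ℤ, Complex.I * n * a ≠ j := by
      intro j h
      have h' := congrArg Complex.im h
      simp only [Complex.mul_im, Complex.mul_re, Complex.I_re, Complex.I_im, Complex.natCast_re,
        Complex.natCast_im, Complex.intCast_im] at h'
      have : (0 : ℝ) < n * a.re := mul_pos (by exact_mod_cast n.pos) ha
      linarith
    refine ((Complex.hasSum_digamma_add_digamma_neg hne).mul_left
      (1 / (n : ℂ) ^ (2 * (M + 1) + 1))).congr_fun fun k => ?_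
    have hk : (k : ℂ) ≠ 0 := Nat.cast_ne_zero.2 k.ne_zero
    have hD := sq_add_sq_mul_sq_ne_zero ha hb hab n k
    have hD' : (k : ℂ) ^ 2 - (Complex.I * n * a) ^ 2 = (k : ℂ) ^ 2 + (n : ℂ) ^ 2 * a ^ 2 := by
      linear_combination (-(n : ℂ) ^ 2 * a ^ 2) * Complex.I_sq
    rw [hD']
    set D := (k : ℂ) ^ 2 + (n : ℂ) ^ 2 * a ^ 2 with hDdef
    simp only [lambertTerm, ← hDdef]
    field_simp
    rw [hDdef]
    ring
  refine ((hs.prod_fiberwise hfib).sub hz).congr_fun fun n => ?_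
  ring
theorem corollary2p4 (α β : ℂ) (hα : 0 < α.re) (hβ : 0 < β.re)
    (hαβ : α * β = 4 * (Real.pi : ℂ) ^ 2) (m : ℕ) (hm : 1 ≤ m) :
    Summable (fun n : ℕ+ => 1 / (n : ℂ) ^ (2 * m + 1) *
      (Complex.digamma (Complex.I * (n : ℂ) * α / (2 * (Real.pi : ℂ))) +
        Complex.digamma (-(Complex.I * (n : ℂ) * α / (2 * (Real.pi : ℂ)))))) ∧
    Summable (fun n : ℕ+ => 1 / (n : ℂ) ^ (2 * m + 1) *
      (Complex.digamma (Complex.I * (n : ℂ) * β / (2 * (Real.pi : ℂ))) +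
        Complex.digamma (-(Complex.I * (n : ℂ) * β / (2 * (Real.pi : ℂ)))))) ∧
    α ^ (-(m : ℤ)) *
        (2 * (Real.eulerMascheroniConstant : ℂ) * riemannZeta (2 * (m : ℂ) + 1) +
          ∑' n : ℕ+, 1 / (n : ℂ) ^ (2 * m + 1) *
            (Complex.digamma (Complex.I * (n : ℂ) * α / (2 * (Real.pi : ℂ))) +
              Complex.digamma (-(Complex.I * (n : ℂ) * α / (2 * (Real.pi : ℂ)))))) =
      -(-β) ^ (-(m : ℤ)) *
          (2 * (Real.eulerMascheroniConstant : ℂ) * riemannZeta (2 * (m : ℂ) + 1) +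
            ∑' n : ℕ+, 1 / (n : ℂ) ^ (2 * m + 1) *
              (Complex.digamma (Complex.I * (n : ℂ) * β / (2 * (Real.pi : ℂ))) +
                Complex.digamma (-(Complex.I * (n : ℂ) * β / (2 * (Real.pi : ℂ)))))) -
        2 * ∑ j ∈ Finset.Icc 1 (m - 1), (-1 : ℂ) ^ j *
          riemannZeta (1 - 2 * (j : ℂ) + 2 * (m : ℂ)) * riemannZeta (2 * (j : ℂ) + 1) *
          α ^ ((j : ℤ) - (m : ℤ)) * β ^ (-(j : ℤ)) := by
  obtain ⟨M, rfl⟩ : ∃ M, m = M + 1 := ⟨m - 1, by omega⟩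
  have hpi : (2 * (Real.pi : ℂ)) ≠ 0 := by
    simp [Real.pi_ne_zero]
  have hre : ∀ z : ℂ, 0 < z.re → 0 < (z / (2 * (Real.pi : ℂ))).re := by
    intro z hz
    rw [show (2 * (Real.pi : ℂ)) = ((2 * Real.pi : ℝ) : ℂ) by push_cast; rfl, Complex.div_ofReal_re]
    exact div_pos hz Real.two_pi_pos
  have hα0 : α ≠ 0 := fun h => by simp [h] at hα
  have hβ0 : β ≠ 0 := fun h => by simp [h] at hβ
  set a := α / (2 * (Real.pi : ℂ)) with ha
  set b := β / (2 * (Real.pi : ℂ)) with hb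
  have hab : a * b = 1 := by
    rw [ha, hb, div_mul_div_comm, hαβ, div_eq_one_iff_eq (mul_ne_zero hpi hpi)]
    ring
  have ha' : 0 < a.re := hre α hα
  have hb' : 0 < b.re := hre β hβ
  have h1 := hasSum_digamma_series M ha' hb' hab
  have h2 := hasSum_digamma_series M hb' ha' (by rw [mul_comm, hab])
  have key := tsum_lambertTerm_add_swap M ha' hb' hab
  -- Since `a² = α/β`, the powers `a^(2j)` become `α^j β^(-j)`, and `(-β)^(-m)` becomes `α^(-m)
  -- (-1)^m a^(2m)`.
  have hαa : α = a ^ 2 * β := by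
    have : α = a * (2 * Real.pi) := (div_mul_cancel₀ _ hpi).symm
    have hb2 : β = b * (2 * Real.pi) := (div_mul_cancel₀ _ hpi).symm
    rw [hb2]
    linear_combination this - a * (2 * Real.pi) * hab
  have ha0 : a ≠ 0 := div_ne_zero hα0 hpi
  simp only [mul_div_assoc, ← ha, ← hb]
  refine ⟨h1.summable, h2.summable, ?_⟩
  rw [h1.tsum_eq, h2.tsum_eq]
  have hζ : riemannZeta (2 * ((M + 1 : ℕ) : ℂ) + 1) = riemannZeta (2 * (M + 1) + 1 : ℕ) := by
    push_cast
    rfl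
  have hsum : ∑ j ∈ Finset.Icc 1 (M + 1 - 1), (-1 : ℂ) ^ j *
        riemannZeta (1 - 2 * (j : ℂ) + 2 * ((M + 1 : ℕ) : ℂ)) * riemannZeta (2 * (j : ℂ) + 1) *
          α ^ ((j : ℤ) - ((M + 1 : ℕ) : ℤ)) * β ^ (-(j : ℤ)) =
      α ^ (-((M + 1 : ℕ) : ℤ)) * ∑ j ∈ Finset.Icc 1 M, (-1) ^ j * a ^ (2 * j) *
        (riemannZeta (2 * (M + 1 - j) + 1 : ℕ) * riemannZeta (2 * j + 1 : ℕ)) := by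
    rw [Finset.mul_sum, Nat.add_sub_cancel]
    refine Finset.sum_congr rfl fun j hj => ?_
    rw [Finset.mem_Icc] at hj
    have z1 : (1 - 2 * (j : ℂ) + 2 * ((M + 1 : ℕ) : ℂ)) = ((2 * (M + 1 - j) + 1 : ℕ) : ℂ) := by
      obtain ⟨d, rfl⟩ := Nat.exists_eq_add_of_le hj.2
      rw [show j + d + 1 - j = d + 1 by omega]
      push_cast
      ring
    have z2 : 2 * (j : ℂ) + 1 = ((2 * j + 1 : ℕ) : ℂ) := by
      push_cast
      rfl
    have z3 : α ^ j * β ^ (-(j : ℤ)) = a ^ (2 * j) := by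
      rw [zpow_neg, zpow_natCast, ← div_eq_mul_inv, ← div_pow, pow_mul]
      congr 1
      rw [div_eq_iff hβ0]
      exact hαa
    rw [z1, z2, sub_eq_neg_add, zpow_add₀ hα0, zpow_natCast, ← z3]
    ring
  have hβp : (-β) ^ (-((M + 1 : ℕ) : ℤ)) =
      α ^ (-((M + 1 : ℕ) : ℤ)) * ((-1) ^ (M + 1) * a ^ (2 * M + 2)) := by
    have : ((-1 : ℂ) ^ (M + 1)) * (-1) ^ (M + 1) = 1 := by
      rw [← mul_pow]
      simp
    rw [zpow_neg, zpow_neg, zpow_natCast, zpow_natCast, inv_eq_iff_eq_inv, mul_inv, inv_inv,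
      eq_mul_inv_iff_mul_eq₀ (by simp [ha0]), neg_pow, hαa, mul_pow, ← pow_mul]
    linear_combination (β ^ (M + 1) * a ^ (2 * M + 2)) * this
  rw [hsum, hβp, hζ]
  linear_combination (2 * α ^ (-((M + 1 : ℕ) : ℤ))) * key
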